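/- For $n\ge 1$ let $\Sigma_n=\{-1,1\}^n$ and, for $X\in\mathbb{R}^n$ and $\sigma\in\Sigma_n$, let $$H(\sigma)=H(\sigma,X)=\frac{1}{\sqrt n}\Bigl|\sum_{i=1}^n\sigma(i)X_i\Bigr| .$$ For $\sigma^*\in\Sigma_n$, let the planted measure $\mathbb{P}_{\rm pl}$ be the law of $X\sim\mathcal{N}(0,I_n)$ conditioned on the event $H(\sigma^*)\le 3^{-n}$, that is, $\mathbb{P}_{\rm pl}[\mathcal{E}]=\mathbb{P}_{X\sim\mathcal{N}(0,I_n)}\bigl[\mathcal{E}\mid H(\sigma^*)\le 3^{-n}\bigr]$ for every event $\mathcal{E}$. Theorem. Let $f,g:\mathbb{N}\to(0,\infty)$ be arbitrary functions with $f(n)\to 0$ and $g(n)\to\infty$ as $n\to\infty$, and for every $n$ let $\sigma^*=\sigma^*_n\in\Sigma_n$ be fixed. Then $$\lim_{n\to\infty}\mathbb{P}_{\rm pl}\Bigl[f(n)\,2^{-n}\le\min_{\sigma\in\Sigma_n\setminus\{\sigma^*,-\sigma^*\}}H(\sigma)\le g(n)\,2^{-n}\Bigr]=1 .$$ (The minimum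 is over a nonempty set as soon as $n\ge 2$.) -/

import Mathlib

open Filter MeasureTheory ProbabilityTheory
open scoped Topology

namespace PlantedNPP

/-- The set `Σ_n = {-1, 1}^n` of partitions (the units of `ℤ` are exactly `1` and `-1`). -/
abbrev Partition (n : ℕ) : Type := Fin n → ℤˣ

/-- The Hamiltonian `H(σ) = n^{-1/2} |⟨σ, X⟩|` of a partition `σ` for the list of numbers `X`. -/
noncomputable def hamiltonian {n : ℕ} (X : EuclideanSpace ℝ (Fin n)) (σ : Partition n) : ℝ :=
  (Real.sqrt n)⁻¹ * |∑ i, ((σ i : ℤ) : ℝ) * X i|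

/-- The planted measure: the law of `X ∼ N(0, I_n)` conditioned on `H(σ*) ≤ 3^{-n}`. -/
noncomputable def plantedMeasure {n : ℕ} (σs : Partition n) :
    Measure (EuclideanSpace ℝ (Fin n)) :=
  ProbabilityTheory.cond (stdGaussian (EuclideanSpace ℝ (Fin n)))
    {X | hamiltonian X σs ≤ (3 : ℝ) ^ (-(n : ℤ))}

/-- The set `Σ_n ∖ {σ*, -σ*}`. -/
def otherPartitions {n : ℕ} (σs : Partition n) : Set (Partition n) :=
  {σ | σ ≠ σs ∧ σ ≠ -σs}

/-- The minimum of `H(σ)` over `σ ∈ Σ_n ∖ {σ*, -σ*}`. For `n ≥ 2` this finite set is nonempty and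
the infimum is attained, see `isLeast_groundStateValue`. -/
noncomputable def groundStateValue {n : ℕ} (σs : Partition n)
    (X : EuclideanSpace ℝ (Fin n)) : ℝ :=
  sInf (hamiltonian X '' otherPartitions σs)

theorem otherPartitions_nonempty {n : ℕ} (hn : 2 ≤ n) (σs : Partition n) :
    (otherPartitions σs).Nonempty := by
  have hne : ∀ u : ℤˣ, u ≠ -u := by decide
  have h10 : (⟨1, by omega⟩ : Fin n) ≠ ⟨0, by omega⟩ := by simp
  refine ⟨Function.update σs ⟨0, by omega⟩ (-σs ⟨0, by omega⟩), fun h => ?_, fun h => ?_⟩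
  · have := congrFun h ⟨0, by omega⟩
    rw [Function.update_self] at this
    exact hne _ this.symm
  · have := congrFun h ⟨1, by omega⟩
    rw [Function.update_of_ne h10] at this
    exact hne _ this

theorem isLeast_groundStateValue {n : ℕ} (hn : 2 ≤ n) (σs : Partition n)
    (X : EuclideanSpace ℝ (Fin n)) :
    IsLeast (hamiltonian X '' otherPartitions σs) (groundStateValue σs X) :=
  ((Set.toFinite _).isCompact).isLeast_sInf ((otherPartitions_nonempty hn σs).image _)

end PlantedNPP

/-!
Write `v_σ = σ / √n` (`unitVector`), a unit vector, so that `H(σ) = |⟪v_σ, X⟫|`. The theorem is a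
first and second moment computation for the number of `σ ≠ ±σ*` with `H(σ) ≤ b`, under the
planted measure.

The component of a standard Gaussian vector along `e` is independent of its projection to the
orthogonal complement of `e`, and has a density at most `(√(2π) ‖e‖)⁻¹`. Removing projections as in
the Gram–Schmidt process therefore gives, conditionally on `H(σ*) ≤ δ`, the small-ball bounds
`κ b / √(1 - a²)` for one partition (`cond_real_slab_le`) and `κ² b² / √D` for two
(`cond_real_slab_inter_slab_le`), where `κ = 2 / √(2π)`, `a` is the overlap with `σ*` and `D` is the
Gram determinant of the three unit vectors. In the other direction the residual has length at most
one, so a single partition has probability at least `κ (b - δ) exp (-b² / 2)` (`le_cond_real_slab`).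

It remains to average `1 / √(1 - a²)` and `1 / √D` over partitions. When the overlaps are small, `D`
is close to one. Otherwise `√D ≥ 2 / n`, since a nontrivial partition has squared distance at least
`2 / n` from the span of two others (`two_div_le_norm_sub_sq`); this polynomial loss is absorbed by
the bound `3 / n²` on the fourth moment of the overlap of two uniform partitions. So the average of
`1 / √D` is at most `1 + O(1 / n)` (`inv_sqrt_gram_le`, `sum_overlapWeight_le`), and that of
`1 / √(1 - a²)` is bounded.

Consequently the expected number of `σ` with `H(σ) ≤ f(n) 2⁻ⁿ` is `O(f(n))`, which gives the lower
bound. For the upper bound take `b = γ 2⁻ⁿ` with `γ = min (g n) n`: the diagonal pairs `τ = ±σ`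
contribute `O(γ)` to the second moment, all other pairs at most `(κ γ)² (1 + O(1 / n))`, and the
first moment is at least `κ γ (1 - o(1))`. Hence the number is positive with probability tending to
one (`le_measureReal_biUnion`, `tendsto_secondMoment_ratio`).
-/

namespace PlantedNPP

open scoped RealInnerProductSpace NNReal

/-! ### Gaussian small-ball estimates -/

theorem gaussianReal_real_Icc_le (m : ℝ) {v : ℝ≥0} (hv : v ≠ 0) {c d : ℝ} (hcd : c ≤ d) :
    (gaussianReal m v).real (Set.Icc c d) ≤ (d - c) * (√(2 * Real.pi * v))⁻¹ := by
  have h0 : 0 ≤ (d - c) * (√(2 * Real.pi * v))⁻¹ :=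
    mul_nonneg (sub_nonneg.2 hcd) (by positivity)
  rw [measureReal_def, gaussianReal_apply_eq_integral _ hv, ENNReal.toReal_ofReal
    (integral_nonneg fun x => gaussianPDFReal_nonneg _ _ _)]
  calc ∫ x in Set.Icc c d, gaussianPDFReal m v x
      ≤ ∫ _ in Set.Icc c d, (√(2 * Real.pi * v))⁻¹ := by
        refine setIntegral_mono_on (integrable_gaussianPDFReal m v).integrableOn
          (integrableOn_const measure_Icc_lt_top.ne) measurableSet_Icc fun x _ => ?_
        rw [gaussianPDFReal]
        refine mul_le_of_le_one_right (by positivity) (Real.exp_le_one_iff.2 ?_)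
        rw [neg_div]
        exact neg_nonpos.2 (by positivity)
    _ = _ := by simp [hcd]

theorem le_gaussianReal_zero_one_real_Icc {t : ℝ} (ht : 0 ≤ t) :
    2 * t * (√(2 * Real.pi))⁻¹ * Real.exp (-t ^ 2 / 2) ≤
      (gaussianReal 0 1).real (Set.Icc (-t) t) := by
  rw [measureReal_def, gaussianReal_apply_eq_integral _ one_ne_zero, ENNReal.toReal_ofReal
    (integral_nonneg fun x => gaussianPDFReal_nonneg _ _ _)]
  calc 2 * t * (√(2 * Real.pi))⁻¹ * Real.exp (-t ^ 2 / 2)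
      = ∫ _ in Set.Icc (-t) t, (√(2 * Real.pi))⁻¹ * Real.exp (-t ^ 2 / 2) := by
        have : (-t) ≤ t := by linarith
        rw [setIntegral_const, Real.volume_real_Icc_of_le this, smul_eq_mul]
        ring
    _ ≤ _ := by
        refine setIntegral_mono_on (integrableOn_const measure_Icc_lt_top.ne)
          (integrable_gaussianPDFReal 0 1).integrableOn measurableSet_Icc fun x hx => ?_
        have : x ^ 2 ≤ t ^ 2 := sq_le_sq' hx.1 hx.2
        simp only [gaussianPDFReal, NNReal.coe_one, mul_one, sub_zero]
        gcongr

/-- A centred Gaussian of variance at most one puts at least as much mass on `[-t, t]` as the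
standard one, being a contraction of it. -/
theorem le_gaussianReal_real_Icc {v : ℝ≥0} (hv : v ≤ 1) {t : ℝ} (ht : 0 ≤ t) :
    2 * t * (√(2 * Real.pi))⁻¹ * Real.exp (-t ^ 2 / 2) ≤
      (gaussianReal 0 v).real (Set.Icc (-t) t) := by
  have hmap : (gaussianReal 0 1).map (√(v : ℝ) * ·) = gaussianReal 0 v := by
    rw [gaussianReal_map_const_mul, mul_zero, mul_one]
    congr 1
    ext
    simp
  rw [← hmap, map_measureReal_apply (by fun_prop) measurableSet_Icc]
  refine (le_gaussianReal_zero_one_real_Icc ht).trans (measureReal_mono fun x hx => ?_)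
  have hs : √(v : ℝ) ≤ 1 := Real.sqrt_le_one.2 (by exact_mod_cast hv)
  have hx' : |x| ≤ t := abs_le.2 hx
  refine abs_le.1 ?_
  rw [abs_mul, abs_of_nonneg (Real.sqrt_nonneg _)]
  exact (mul_le_of_le_one_left (abs_nonneg x) hs).trans hx'

section Slab

variable {E : Type*} [NormedAddCommGroup E] [InnerProductSpace ℝ E]

theorem inner_sub_inner_smul {u : E} (hu : ‖u‖ = 1) (w : E) : ⟪u, w - ⟪u, w⟫ • u⟫ = 0 := by
  rw [inner_sub_right, real_inner_smul_right, real_inner_self_eq_norm_sq, hu]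
  ring

theorem norm_sub_inner_smul_sq {u w : E} (hu : ‖u‖ = 1) (hw : ‖w‖ = 1) :
    ‖w - ⟪u, w⟫ • u‖ ^ 2 = 1 - ⟪u, w⟫ ^ 2 := by
  rw [norm_sub_sq_real, norm_smul, real_inner_smul_right, real_inner_comm u w, hu, hw, mul_one,
    Real.norm_eq_abs, sq_abs]
  ring

/-- An event invariant under translations along `e` is determined by the projection to the
orthogonal complement of `e`. -/
theorem preimage_orthogonal_projection {e : E} {A : Set E}
    (hA : ∀ x (t : ℝ), x - t • e ∈ A ↔ x ∈ A) :
    (fun x : E => x - (⟪e, x⟫ / ‖e‖ ^ 2) • e) ⁻¹' A = A := by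
  ext x
  exact hA x _

/-- The slab `{x | |⟪u, x⟫| ≤ δ}`. With `u = σ / √n` it is the event `H(σ) ≤ δ`, both for the
planted partition and for the others. -/
def slab (u : E) (δ : ℝ) : Set E := {x | |⟪u, x⟫| ≤ δ}

theorem sub_smul_mem_slab {u e : E} (h : ⟪u, e⟫ = 0) {δ : ℝ} (x : E) (t : ℝ) :
    x - t • e ∈ slab u δ ↔ x ∈ slab u δ := by
  simp [slab, inner_sub_right, real_inner_smul_right, h]

/-- The Gram determinant of three unit vectors `u`, `w`, `w'`. -/
def gramDet (u w w' : E) : ℝ :=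
  (1 - ⟪u, w⟫ ^ 2) * (1 - ⟪u, w'⟫ ^ 2) - (⟪w, w'⟫ - ⟪u, w⟫ * ⟪u, w'⟫) ^ 2

/-- The Gram determinant of three unit vectors is the product of the squared lengths of the
vectors that the Gram–Schmidt process makes of them. -/
theorem one_sub_inner_sq_mul_norm_sq {u w w' : E} (hu : ‖u‖ = 1) (hw : ‖w‖ = 1) (hw' : ‖w'‖ = 1)
    (huw : ⟪u, w⟫ ^ 2 < 1) :
    (1 - ⟪u, w⟫ ^ 2) * ‖w' - ⟪u, w'⟫ • u -
      ((⟪w, w'⟫ - ⟪u, w⟫ * ⟪u, w'⟫) / (1 - ⟪u, w⟫ ^ 2)) • (w - ⟪u, w⟫ • u)‖ ^ 2 =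
      gramDet u w w' := by
  have hs : 1 - ⟪u, w⟫ ^ 2 ≠ 0 := (sub_pos.2 huw).ne'
  have huu : ⟪u, u⟫ = 1 := by rw [real_inner_self_eq_norm_sq, hu]; norm_num
  have hww : ⟪w, w⟫ = 1 := by rw [real_inner_self_eq_norm_sq, hw]; norm_num
  have hww' : ⟪w', w'⟫ = 1 := by rw [real_inner_self_eq_norm_sq, hw']; norm_num
  rw [← real_inner_self_eq_norm_sq, gramDet]
  simp only [inner_sub_left, inner_sub_right, real_inner_smul_left, real_inner_smul_right,
    huu, hww, hww', real_inner_comm u w, real_inner_comm u w', real_inner_comm w w']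
  field_simp
  ring

theorem inner_sq_le_one {u w : E} (hu : ‖u‖ = 1) (hw : ‖w‖ = 1) : ⟪u, w⟫ ^ 2 ≤ 1 := by
  have : |⟪u, w⟫| ≤ 1 := by simpa [hu, hw] using abs_real_inner_le_norm u w
  exact (sq_le_one_iff_abs_le_one _).2 this

/-- Lower bounds on the distance of `w` to the line through `u` and of `w'` to the plane through
`u` and `w` bound the Gram determinant from below. -/
theorem sq_le_gramDet {u w w' : E} (hu : ‖u‖ = 1) (hw : ‖w‖ = 1) (hw' : ‖w'‖ = 1) {m : ℝ}
    (hm : 0 < m) (h1 : ∀ β : ℝ, m ≤ ‖w - β • u‖ ^ 2)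
    (h2 : ∀ α β : ℝ, m ≤ ‖w' - α • u - β • w‖ ^ 2) : m ^ 2 ≤ gramDet u w w' := by
  have h1' := h1 ⟪u, w⟫
  rw [norm_sub_inner_smul_sq hu hw] at h1'
  rw [← one_sub_inner_sq_mul_norm_sq hu hw hw' (by linarith), sq]
  refine mul_le_mul h1' ?_ hm.le (hm.le.trans h1')
  set k := (⟪w, w'⟫ - ⟪u, w⟫ * ⟪u, w'⟫) / (1 - ⟪u, w⟫ ^ 2)
  have hk : w' - ⟪u, w'⟫ • u - k • (w - ⟪u, w⟫ • u) =
      w' - (⟪u, w'⟫ - k * ⟪u, w⟫) • u - k • w := by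
    rw [smul_sub, sub_smul, smul_smul]
    abel
  rw [hk]
  exact h2 _ _

end Slab

section StdGaussian

variable {E : Type*} [NormedAddCommGroup E] [InnerProductSpace ℝ E] [FiniteDimensional ℝ E]
  [MeasurableSpace E] [BorelSpace E]

theorem stdGaussian_map_inner (e : E) :
    (stdGaussian E).map (fun x => ⟪e, x⟫) = gaussianReal 0 (‖e‖₊ ^ 2) := by
  have h := IsGaussian.map_eq_gaussianReal (μ := stdGaussian E) (innerSL ℝ e)
  rw [integral_strongDual_stdGaussian, variance_dual_stdGaussian, innerSL_apply_norm] at h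
  have hv : (‖e‖ ^ 2).toNNReal = ‖e‖₊ ^ 2 := by
    rw [Real.toNNReal_pow (norm_nonneg e), norm_toNNReal]
  rw [hv] at h
  exact h

/-- The component of a standard Gaussian vector along `e` is independent of the projection to
the orthogonal complement of `e`. -/
theorem indepFun_orthogonal_projection_inner (e : E) :
    IndepFun (fun x : E => x - (⟪e, x⟫ / ‖e‖ ^ 2) • e) (fun x => ⟪e, x⟫) (stdGaussian E) := by
  let P : E →L[ℝ] E := ContinuousLinearMap.id ℝ E - (‖e‖ ^ 2)⁻¹ • (innerSL ℝ e).smulRight e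
  have hP : ∀ x, P x = x - (⟪e, x⟫ / ‖e‖ ^ 2) • e := fun x => by
    simp [P, smul_smul, div_eq_inv_mul]
  have hPe : P e = 0 := by
    rcases eq_or_ne e 0 with rfl | he
    · simp
    · rw [hP, real_inner_self_eq_norm_sq, div_self (by positivity), one_smul, sub_self]
  have hid : HasGaussianLaw (id : E → E) (stdGaussian E) := IsGaussian.hasGaussianLaw_id
  have hG : HasGaussianLaw (fun x => (P x, innerSL ℝ e x)) (stdGaussian E) :=
    hid.map (P.prod (innerSL ℝ e))
  have hind := hG.indepFun_of_covariance_strongDual (fun L₁ L₂ => ?_)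
  · have hP' : (fun x : E => x - (⟪e, x⟫ / ‖e‖ ^ 2) • e) = fun x => P x :=
      funext fun x => (hP x).symm
    rw [hP']
    exact hind
  · have h1 : (L₁ ∘ fun x => P x) =
        fun x => ⟪(InnerProductSpace.toDual ℝ E).symm (L₁ ∘L P), x⟫ := by
      ext x; simp
    have h2 : (L₂ ∘ fun x => innerSL ℝ e x) = fun x => ⟪L₂ 1 • e, x⟫ := by
      ext x
      have := L₂.map_smul ⟪e, x⟫ 1
      simp only [smul_eq_mul, mul_one] at this
      simp [this, real_inner_smul_left, mul_comm]
    rw [h1, h2, ← covarianceBilin_apply_eq_cov IsGaussian.memLp_two_id,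
      covarianceBilin_stdGaussian, innerSL_apply_apply]
    simp [hPe]

/-- Conditionally on an event `A` that does not depend on the component along `e`, the random
variable `⟪r + e, X⟫` with `r` orthogonal to `e` has a density at most `(√(2π) ‖e‖)⁻¹`. -/
theorem stdGaussian_real_inter_slab_le {e r : E} (he : e ≠ 0) (hre : ⟪r, e⟫ = 0) {A : Set E}
    (hAm : MeasurableSet A) (hA : ∀ x (t : ℝ), x - t • e ∈ A ↔ x ∈ A) {b : ℝ} (hb : 0 ≤ b) :
    (stdGaussian E).real (A ∩ {x | |⟪r + e, x⟫| ≤ b}) ≤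
      (stdGaussian E).real A * (2 * b * (√(2 * Real.pi))⁻¹ / ‖e‖) := by
  set γ := stdGaussian E with hγ
  set P : E → E := fun x => x - (⟪e, x⟫ / ‖e‖ ^ 2) • e with hPdef
  have hPm : Measurable P := by fun_prop
  have hprod : γ.map (fun x => (P x, ⟪e, x⟫)) =
      (γ.map P).prod (γ.map (fun x => ⟪e, x⟫)) :=
    (indepFun_iff_map_prod_eq_prod_map_map hPm.aemeasurable (by fun_prop)).1
      (indepFun_orthogonal_projection_inner e)
  let S : Set (E × ℝ) := {p | p.1 ∈ A ∧ |⟪r, p.1⟫ + p.2| ≤ b}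
  have hSm : MeasurableSet S := by
    have h1 : MeasurableSet {p : E × ℝ | p.1 ∈ A} := measurable_fst hAm
    have h2 : MeasurableSet {p : E × ℝ | |⟪r, p.1⟫ + p.2| ≤ b} :=
      measurableSet_le (by fun_prop) measurable_const
    exact h1.inter h2
  have hpre : A ∩ {x | |⟪r + e, x⟫| ≤ b} = (fun x => (P x, ⟪e, x⟫)) ⁻¹' S := by
    ext x
    have h1 : P x ∈ A ↔ x ∈ A := hA x _
    have h2 : ⟪r, P x⟫ = ⟪r, x⟫ := by
      simp [hPdef, inner_sub_right, real_inner_smul_right, hre]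
    simp only [S, Set.mem_inter_iff, Set.mem_ofPred_eq, Set.mem_preimage, h1, h2, inner_add_left]
  have hAP : γ A = (γ.map P) A := by
    rw [Measure.map_apply hPm hAm, preimage_orthogonal_projection hA]
  set c : ℝ := 2 * b * (√(2 * Real.pi))⁻¹ / ‖e‖ with hc
  have hc0 : 0 ≤ c := by positivity
  have hv : (‖e‖₊ ^ 2 : ℝ≥0) ≠ 0 := pow_ne_zero _ (nnnorm_ne_zero_iff.2 he)
  have hle : γ (A ∩ {x | |⟪r + e, x⟫| ≤ b}) ≤ γ A * ENNReal.ofReal c := by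
    have : IsProbabilityMeasure (γ.map P) := Measure.isProbabilityMeasure_map hPm.aemeasurable
    rw [hpre, ← Measure.map_apply (by fun_prop) hSm, hprod, stdGaussian_map_inner,
      Measure.prod_apply hSm, hAP, mul_comm, ← lintegral_indicator_const hAm]
    refine lintegral_mono fun y => ?_
    by_cases hy : y ∈ A
    · have hset : Prod.mk y ⁻¹' S = Set.Icc (-b - ⟪r, y⟫) (b - ⟪r, y⟫) := by
        ext z
        simp only [S, Set.mem_preimage, Set.mem_ofPred_eq, hy, true_and, Set.mem_Icc, abs_le]
        constructor <;> rintro ⟨h1, h2⟩ <;> constructor <;> linarith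
      rw [Set.indicator_of_mem hy, hset, ← ENNReal.ofReal_toReal (measure_ne_top _ _)]
      refine ENNReal.ofReal_le_ofReal ((gaussianReal_real_Icc_le 0 hv (by linarith)).trans_eq ?_)
      rw [hc, NNReal.coe_pow, coe_nnnorm, Real.sqrt_mul (by positivity),
        Real.sqrt_sq (norm_nonneg e), mul_inv]
      ring
    · have hset : Prod.mk y ⁻¹' S = ∅ := by
        ext z
        simp [S, hy]
      rw [hset]
      simp
  have := ENNReal.toReal_mono (ENNReal.mul_ne_top (measure_ne_top _ _) ENNReal.ofReal_ne_top) hle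
  rwa [ENNReal.toReal_mul, ENNReal.toReal_ofReal hc0] at this

theorem le_stdGaussian_real_inter_slab {e : E} (he : ‖e‖ ≤ 1) {A : Set E}
    (hAm : MeasurableSet A) (hA : ∀ x (t : ℝ), x - t • e ∈ A ↔ x ∈ A) {b : ℝ} (hb : 0 ≤ b) :
    (stdGaussian E).real A * (2 * b * (√(2 * Real.pi))⁻¹ * Real.exp (-b ^ 2 / 2)) ≤
      (stdGaussian E).real (A ∩ {x | |⟪e, x⟫| ≤ b}) := by
  have hset : {x : E | |⟪e, x⟫| ≤ b} = (fun x => ⟪e, x⟫) ⁻¹' Set.Icc (-b) b := by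
    ext x
    simp [abs_le]
  have hind := (indepFun_orthogonal_projection_inner e).measure_inter_preimage_eq_mul A
    (Set.Icc (-b) b) hAm measurableSet_Icc
  rw [preimage_orthogonal_projection hA, ← Measure.map_apply (f := fun x => ⟪e, x⟫) (by fun_prop)
    measurableSet_Icc, stdGaussian_map_inner] at hind
  rw [hset, measureReal_def (s := A ∩ _), hind, ENNReal.toReal_mul]
  refine mul_le_mul_of_nonneg_left (le_gaussianReal_real_Icc ?_ hb) measureReal_nonneg
  exact pow_le_one₀ (by positivity) (by exact_mod_cast he)

theorem measurableSet_slab (u : E) (δ : ℝ) : MeasurableSet (slab u δ) :=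
  measurableSet_le (by fun_prop) measurable_const

theorem stdGaussian_real_slab_pos {u : E} (hu : ‖u‖ = 1) {δ : ℝ} (hδ : 0 < δ) :
    0 < (stdGaussian E).real (slab u δ) := by
  have h := le_stdGaussian_real_inter_slab (e := u) hu.le (A := Set.univ) MeasurableSet.univ
    (by simp) hδ.le
  rw [Set.univ_inter] at h
  refine lt_of_lt_of_le ?_ h
  rw [probReal_univ, one_mul]
  positivity

theorem cond_real_slab (u : E) (δ : ℝ) (A : Set E) :
    ((stdGaussian E)[|slab u δ]).real A =
      ((stdGaussian E).real (slab u δ))⁻¹ * (stdGaussian E).real (slab u δ ∩ A) := by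
  rw [measureReal_def, cond_apply (measurableSet_slab u δ), ENNReal.toReal_mul, ENNReal.toReal_inv]
  rfl

theorem cond_real_slab_le {u w : E} (hu : ‖u‖ = 1) (hw : ‖w‖ = 1) (huw : ⟪u, w⟫ ^ 2 < 1)
    {δ b : ℝ} (hδ : 0 < δ) (hb : 0 ≤ b) :
    ((stdGaussian E)[|slab u δ]).real (slab w b) ≤
      2 * b * (√(2 * Real.pi))⁻¹ / √(1 - ⟪u, w⟫ ^ 2) := by
  set a : ℝ := ⟪u, w⟫ with ha
  set e : E := w - a • u with he
  have hne : ‖e‖ ^ 2 = 1 - a ^ 2 := norm_sub_inner_smul_sq hu hw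
  have hue : ⟪u, e⟫ = 0 := inner_sub_inner_smul hu w
  have he0 : e ≠ 0 := by
    intro h
    rw [h, norm_zero] at hne
    linarith
  have hpos := stdGaussian_real_slab_pos hu hδ
  have h := stdGaussian_real_inter_slab_le (r := a • u) he0
    (by rw [real_inner_smul_left, hue, mul_zero]) (measurableSet_slab u δ)
    (sub_smul_mem_slab hue) hb
  rw [show a • u + e = w by simp [he]] at h
  rw [cond_real_slab, ← hne, Real.sqrt_sq (norm_nonneg e), inv_mul_le_iff₀ hpos]
  exact h

/-- The residual of `w` after projecting to `u` has length at most one, and on the slab around `u`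
the removed part of `⟪w, x⟫` is at most `δ`. -/
theorem le_cond_real_slab {u w : E} (hu : ‖u‖ = 1) (hw : ‖w‖ = 1)
    {δ b : ℝ} (hδ : 0 < δ) (hb : δ ≤ b) :
    2 * (b - δ) * (√(2 * Real.pi))⁻¹ * Real.exp (-b ^ 2 / 2) ≤
      ((stdGaussian E)[|slab u δ]).real (slab w b) := by
  set a : ℝ := ⟪u, w⟫ with ha
  set e : E := w - a • u with he
  have hne : ‖e‖ ^ 2 = 1 - a ^ 2 := norm_sub_inner_smul_sq hu hw
  have hue : ⟪u, e⟫ = 0 := inner_sub_inner_smul hu w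
  have ha1 : |a| ≤ 1 := by simpa [hu, hw] using abs_real_inner_le_norm u w
  have he1 : ‖e‖ ≤ 1 := by
    have := sq_nonneg a
    exact abs_le_one_iff_mul_self_le_one.2 (by nlinarith) |>.trans' (le_abs_self _)
  have hpos := stdGaussian_real_slab_pos hu hδ
  have h := le_stdGaussian_real_inter_slab he1 (measurableSet_slab u δ)
    (sub_smul_mem_slab hue) (sub_nonneg.2 hb)
  rw [cond_real_slab, ← div_eq_inv_mul, le_div_iff₀' hpos]
  calc _ ≤ (stdGaussian E).real (slab u δ) *
        (2 * (b - δ) * (√(2 * Real.pi))⁻¹ * Real.exp (-(b - δ) ^ 2 / 2)) := by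
        have : 0 ≤ b - δ := sub_nonneg.2 hb
        gcongr
        linarith
    _ ≤ _ := h
    _ ≤ _ := by
        refine measureReal_mono ?_
        rintro x ⟨hx1, hx2⟩
        refine ⟨hx1, ?_⟩
        simp only [slab, Set.mem_ofPred_eq] at hx1 hx2 ⊢
        have hw' : ⟪w, x⟫ = ⟪e, x⟫ + a * ⟪u, x⟫ := by
          simp [he, inner_sub_left, real_inner_smul_left]
        have h1 : |a * ⟪u, x⟫| ≤ δ := by
          rw [abs_mul]
          exact (mul_le_of_le_one_left (abs_nonneg _) ha1).trans hx1
        rw [hw']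
        exact (abs_add_le _ _).trans (by linarith)

/-- Joint small-ball bound for two directions given a third one: subtracting projections as in the
Gram–Schmidt process makes the three Gaussian coordinates independent. -/
theorem cond_real_slab_inter_slab_le {u w w' : E} (hu : ‖u‖ = 1) (hw : ‖w‖ = 1) (hw' : ‖w'‖ = 1)
    (hD : 0 < gramDet u w w') {δ b : ℝ} (hδ : 0 < δ) (hb : 0 ≤ b) :
    ((stdGaussian E)[|slab u δ]).real (slab w b ∩ slab w' b) ≤
      (2 * b * (√(2 * Real.pi))⁻¹) ^ 2 / √(gramDet u w w') := by
  set a : ℝ := ⟪u, w⟫ with ha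
  set a' : ℝ := ⟪u, w'⟫ with ha'
  set c : ℝ := ⟪w, w'⟫ with hc
  have ha1 : a ^ 2 ≤ 1 := inner_sq_le_one hu hw
  have ha2 : a ^ 2 < 1 := by
    refine lt_of_le_of_ne ha1 fun h => ?_
    rw [gramDet, ← ha, ← ha', ← hc, h] at hD
    nlinarith [sq_nonneg (c - a * a')]
  set s : ℝ := 1 - a ^ 2 with hs
  have hs0 : 0 < s := sub_pos.2 ha2
  set e : E := w - a • u with he
  set k : ℝ := (c - a * a') / s with hk
  set e' : E := w' - a' • u - k • e with he'
  have huu : ⟪u, u⟫ = 1 := by rw [real_inner_self_eq_norm_sq, hu]; norm_num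
  have hue : ⟪u, e⟫ = 0 := inner_sub_inner_smul hu w
  have heu : ⟪e, u⟫ = 0 := by rw [real_inner_comm, hue]
  have hne : ‖e‖ ^ 2 = s := norm_sub_inner_smul_sq hu hw
  have hee : ⟪e, e⟫ = s := by rw [real_inner_self_eq_norm_sq, hne]
  have hew' : ⟪e, w'⟫ = c - a * a' := by
    simp [he, inner_sub_left, real_inner_smul_left, ← ha', ← hc]
  have hue' : ⟪u, e'⟫ = 0 := by
    simp only [he', inner_sub_right, real_inner_smul_right, huu, ← ha', hue]
    ring
  have hks : k * s = c - a * a' := div_mul_cancel₀ _ hs0.ne'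
  have hee' : ⟪e, e'⟫ = 0 := by
    simp only [he', inner_sub_right, real_inner_smul_right, heu, hee, hew', hks]
    ring
  have hwe' : ⟪w, e'⟫ = 0 := by
    have : w = e + a • u := by simp [he]
    rw [this, inner_add_left, real_inner_smul_left, hee', hue']
    simp
  have hne' : s * ‖e'‖ ^ 2 = gramDet u w w' := one_sub_inner_sq_mul_norm_sq hu hw hw' ha2
  have he0 : e ≠ 0 := by
    intro h
    rw [h, norm_zero] at hne
    norm_num at hne
    linarith
  have he0' : e' ≠ 0 := by
    intro h
    rw [h, norm_zero] at hne'
    norm_num at hne'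
    linarith
  have hpos := stdGaussian_real_slab_pos hu hδ
  have h1 := stdGaussian_real_inter_slab_le (r := a • u) he0
    (by rw [real_inner_smul_left, hue, mul_zero]) (measurableSet_slab u δ)
    (sub_smul_mem_slab hue) hb
  rw [show a • u + e = w by simp [he]] at h1
  have h2 := stdGaussian_real_inter_slab_le (r := a' • u + k • e) (A := slab u δ ∩ slab w b) he0'
    (by rw [inner_add_left, real_inner_smul_left, real_inner_smul_left, hue', hee']; simp)
    ((measurableSet_slab u δ).inter (measurableSet_slab w b))
    (fun x t => and_congr (sub_smul_mem_slab hue' x t) (sub_smul_mem_slab hwe' x t)) hb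
  rw [show a' • u + k • e + e' = w' by simp [he']] at h2
  have hsqrt : √(gramDet u w w') = ‖e‖ * ‖e'‖ := by
    rw [← hne', ← hne, ← mul_pow, Real.sqrt_sq (by positivity)]
  rw [cond_real_slab, hsqrt, inv_mul_le_iff₀ hpos, ← Set.inter_assoc]
  refine h2.trans ((mul_le_mul_of_nonneg_right h1 (by positivity)).trans_eq ?_)
  field_simp

end StdGaussian

/-! ### Overlaps of partitions -/

/-- Summation over the first sign of a partition, the recursion behind the moments of the sum of
the signs. -/
theorem sum_partition_succ {M : Type*} [AddCommMonoid M] {n : ℕ} (F : ℝ → M) :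
    ∑ σ : Partition (n + 1), F (∑ i, ((σ i : ℤ) : ℝ)) =
      ∑ σ : Partition n, (F (1 + ∑ i, ((σ i : ℤ) : ℝ)) + F (-1 + ∑ i, ((σ i : ℤ) : ℝ))) := by
  rw [← (Fin.consEquiv fun _ => ℤˣ).sum_comp, Fintype.sum_prod_type, Finset.sum_add_distrib]
  have huniv : (Finset.univ : Finset ℤˣ) = {1, -1} := rfl
  rw [huniv, Finset.sum_pair (by decide)]
  simp [Fin.sum_univ_succ, Fin.consEquiv]

theorem sum_partition_sq (n : ℕ) :
    ∑ σ : Partition n, (∑ i, ((σ i : ℤ) : ℝ)) ^ 2 = 2 ^ n * n := by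
  induction n with
  | zero => simp
  | succ n ih =>
    rw [sum_partition_succ (fun x => x ^ 2)]
    have : ∀ x : ℝ, (1 + x) ^ 2 + (-1 + x) ^ 2 = 2 * x ^ 2 + 2 := fun x => by ring
    simp only [this, Finset.sum_add_distrib, ← Finset.mul_sum, ih]
    simp
    ring

theorem sum_partition_pow_four (n : ℕ) :
    ∑ σ : Partition n, (∑ i, ((σ i : ℤ) : ℝ)) ^ 4 = 2 ^ n * (3 * n ^ 2 - 2 * n) := by
  induction n with
  | zero => simp
  | succ n ih =>
    rw [sum_partition_succ (fun x => x ^ 4)]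
    have : ∀ x : ℝ, (1 + x) ^ 4 + (-1 + x) ^ 4 = 2 * x ^ 4 + 12 * x ^ 2 + 2 := fun x => by ring
    simp only [this, Finset.sum_add_distrib, ← Finset.mul_sum, ih, sum_partition_sq]
    simp
    ring

/-- The vector `σ / √n`, of unit length, so that `H(σ) = |⟪unitVector σ, X⟫|`. -/
noncomputable def unitVector {n : ℕ} (σ : Partition n) : EuclideanSpace ℝ (Fin n) :=
  WithLp.toLp 2 fun i => (√n)⁻¹ * ((σ i : ℤ) : ℝ)

theorem hamiltonian_eq {n : ℕ} (X : EuclideanSpace ℝ (Fin n)) (σ : Partition n) :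
    hamiltonian X σ = |⟪unitVector σ, X⟫| := by
  have : ⟪unitVector σ, X⟫ = (√n)⁻¹ * ∑ i, ((σ i : ℤ) : ℝ) * X i := by
    simp only [unitVector, PiLp.inner_apply, Finset.mul_sum, RCLike.inner_apply, conj_trivial]
    exact Finset.sum_congr rfl fun i _ => by ring
  rw [this, abs_mul, abs_of_nonneg (by positivity : 0 ≤ (√(n : ℝ))⁻¹), hamiltonian]

theorem inner_unitVector {n : ℕ} (σ τ : Partition n) :
    ⟪unitVector σ, unitVector τ⟫ = (n : ℝ)⁻¹ * ∑ i, (((τ * σ) i : ℤˣ) : ℤ) := by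
  simp only [unitVector, PiLp.inner_apply, RCLike.inner_apply, conj_trivial]
  push_cast
  rw [Finset.mul_sum]
  refine Finset.sum_congr rfl fun i _ => ?_
  have : (√(n : ℝ))⁻¹ * (√(n : ℝ))⁻¹ = (n : ℝ)⁻¹ := by
    rw [← mul_inv, Real.mul_self_sqrt (Nat.cast_nonneg n)]
  rw [← this]
  simp
  ring

theorem norm_unitVector {n : ℕ} (hn : n ≠ 0) (σ : Partition n) : ‖unitVector σ‖ = 1 := by
  have h : ‖unitVector σ‖ ^ 2 = 1 := by
    have : σ * σ = 1 := funext fun i => Int.units_mul_self _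
    rw [← real_inner_self_eq_norm_sq, inner_unitVector, this]
    simp [hn]
  exact (pow_eq_one_iff_of_nonneg (norm_nonneg _) two_ne_zero).1 h

theorem sum_inner_unitVector_sq {n : ℕ} (hn : n ≠ 0) (σ : Partition n) :
    ∑ τ : Partition n, ⟪unitVector σ, unitVector τ⟫ ^ 2 = 2 ^ n / n := by
  have h := sum_partition_sq n
  rw [← Equiv.sum_comp (Equiv.mulRight σ)] at h
  simp only [inner_unitVector, mul_pow, ← Finset.mul_sum]
  push_cast
  simp only [Equiv.coe_mulRight] at h
  rw [h]
  field_simp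

theorem sum_inner_unitVector_pow_four_le {n : ℕ} (hn : n ≠ 0) (σ : Partition n) :
    ∑ τ : Partition n, ⟪unitVector σ, unitVector τ⟫ ^ 4 ≤ 2 ^ n * 3 / n ^ 2 := by
  have h := sum_partition_pow_four n
  rw [← Equiv.sum_comp (Equiv.mulRight σ)] at h
  simp only [inner_unitVector, mul_pow, ← Finset.mul_sum]
  push_cast
  simp only [Equiv.coe_mulRight] at h
  rw [h]
  have hn' : (0 : ℝ) < n := by positivity
  rw [le_div_iff₀ (by positivity)]
  calc (n : ℝ)⁻¹ ^ 4 * (2 ^ n * (3 * n ^ 2 - 2 * n)) * n ^ 2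
      ≤ (n : ℝ)⁻¹ ^ 4 * (2 ^ n * (3 * n ^ 2)) * n ^ 2 := by gcongr; linarith
    _ = 2 ^ n * 3 := by field_simp

/-- If `τ` is neither `±σ` nor `±ρ`, then two coordinates distinguish `τ` from `ρ` while `σ` and
`ρ` have the same relative sign at both. -/
theorem exists_mul_eq_mul_ne {n : ℕ} {ρ σ τ : Partition n} (h1 : τ ≠ ρ) (h2 : τ ≠ -ρ)
    (h3 : τ ≠ σ) (h4 : τ ≠ -σ) :
    ∃ i j, ρ i * σ i = ρ j * σ j ∧ ρ i * τ i = 1 ∧ ρ j * τ j = -1 := by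
  by_contra! h
  have hmul : ∀ (x y : Partition n) (k : Fin n), x k * y k = 1 → y k = x k := fun x y k hk => by
    rw [← one_mul (y k), ← Int.units_mul_self (x k), mul_assoc, hk, mul_one]
  have hmul' : ∀ (x y : Partition n) (k : Fin n), x k * y k = -1 → y k = -x k := fun x y k hk => by
    rw [← one_mul (y k), ← Int.units_mul_self (x k), mul_assoc, hk, mul_neg_one]
  obtain ⟨i, hi⟩ : ∃ i, ρ i * τ i = 1 := by
    by_contra! hc
    exact h2 (funext fun k => hmul' ρ τ k ((Int.units_eq_one_or _).resolve_left (hc k)))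
  obtain ⟨j, hj⟩ : ∃ j, ρ j * τ j = -1 := by
    by_contra! hc
    exact h1 (funext fun k => hmul ρ τ k ((Int.units_eq_one_or _).resolve_right (hc k)))
  have hij : ρ i * σ i ≠ ρ j * σ j := fun hc => h i j hc hi hj
  rcases Int.units_eq_one_or (ρ i * σ i) with hi' | hi'
  · have hj' : ρ j * σ j = -1 :=
      (Int.units_eq_one_or _).resolve_left fun hc => hij (hi'.trans hc.symm)
    refine h3 (funext fun k => ?_)
    rcases Int.units_eq_one_or (ρ k * τ k) with hk | hk
    · have : ρ k * σ k = 1 :=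
        (Int.units_eq_one_or _).resolve_right fun hc => h k j (hc.trans hj'.symm) hk hj
      rw [hmul ρ τ k hk, hmul ρ σ k this]
    · have : ρ k * σ k = -1 :=
        (Int.units_eq_one_or _).resolve_left fun hc => h i k (hi'.trans hc.symm) hi hk
      rw [hmul' ρ τ k hk, hmul' ρ σ k this]
  · have hj' : ρ j * σ j = 1 :=
      (Int.units_eq_one_or _).resolve_right fun hc => hij (hi'.trans hc.symm)
    refine h4 (funext fun k => ?_)
    rcases Int.units_eq_one_or (ρ k * τ k) with hk | hk
    · have : ρ k * σ k = -1 :=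
        (Int.units_eq_one_or _).resolve_left fun hc => h k j (hc.trans hj'.symm) hk hj
      rw [hmul ρ τ k hk, Pi.neg_apply, hmul' ρ σ k this, neg_neg]
    · have : ρ k * σ k = 1 :=
        (Int.units_eq_one_or _).resolve_right fun hc => h i k (hi'.trans hc.symm) hi hk
      rw [hmul' ρ τ k hk, Pi.neg_apply, hmul ρ σ k this]

/-- The distance of `τ / √n` to the span of two other partitions: subtracting a combination of `ρ`
and `σ` leaves entries that differ by `2 / √n` up to sign in two coordinates. -/
theorem two_div_le_norm_sub_sq {n : ℕ} (hn : n ≠ 0) {ρ σ τ : Partition n} (h1 : τ ≠ ρ)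
    (h2 : τ ≠ -ρ) (h3 : τ ≠ σ) (h4 : τ ≠ -σ) (α β : ℝ) :
    2 / (n : ℝ) ≤ ‖unitVector τ - α • unitVector ρ - β • unitVector σ‖ ^ 2 := by
  obtain ⟨i, j, hij, hi, hj⟩ := exists_mul_eq_mul_ne h1 h2 h3 h4
  have hne : i ≠ j := by
    rintro rfl
    rw [hi] at hj
    exact absurd hj (by decide)
  set x := unitVector τ - α • unitVector ρ - β • unitVector σ with hx
  have hle : x i ^ 2 + x j ^ 2 ≤ ‖x‖ ^ 2 := by
    rw [EuclideanSpace.real_norm_sq_eq, ← Finset.sum_pair (f := fun k => x k ^ 2) hne]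
    exact Finset.sum_le_univ_sum_of_nonneg fun k => sq_nonneg _
  refine le_trans ?_ hle
  have hcoord : ∀ k, x k ^ 2 =
      (n : ℝ)⁻¹ * (((ρ k * τ k : ℤˣ) : ℤ) - α - β * ((ρ k * σ k : ℤˣ) : ℤ)) ^ 2 := by
    intro k
    have hρ : (((ρ k : ℤ) : ℝ)) * (ρ k : ℤ) = 1 := by
      rw [← Int.cast_mul, ← Units.val_mul, Int.units_mul_self, Units.val_one, Int.cast_one]
    have hs : (√(n : ℝ))⁻¹ ^ 2 = (n : ℝ)⁻¹ := by
      rw [inv_pow, Real.sq_sqrt (Nat.cast_nonneg n)]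
    have hxk : x k = (√(n : ℝ))⁻¹ * ((τ k : ℤ) - α * (ρ k : ℤ) - β * (σ k : ℤ)) := by
      simp [hx, unitVector]
      ring
    rw [hxk, mul_pow, hs]
    push_cast
    congr 1
    linear_combination -(((τ k : ℤ) : ℝ) ^ 2 - α ^ 2 + β ^ 2 * (σ k : ℤ) ^ 2 -
      2 * β * (τ k : ℤ) * (σ k : ℤ)) * hρ
  rw [hcoord, hcoord, hi, hj, hij]
  set c := β * (((ρ j * σ j : ℤˣ) : ℤ) : ℝ)
  have : 0 < (n : ℝ)⁻¹ := by positivity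
  push_cast
  rw [div_eq_inv_mul, ← mul_add]
  gcongr
  nlinarith [sq_nonneg (α + c)]

theorem le_sqrt_of_nonneg_of_le_one {x : ℝ} (h0 : 0 ≤ x) (h1 : x ≤ 1) : x ≤ √x :=
  Real.le_sqrt_of_sq_le (by nlinarith)

/-- A pointwise bound that averages well: for a large overlap `a` the worst case `n / 2` is
dominated by `n * a ^ 2`, whose average over partitions is one. -/
theorem inv_sqrt_one_sub_le {n : ℕ} (hn : n ≠ 0) {a : ℝ} (h : 2 / (n : ℝ) ≤ 1 - a ^ 2) :
    (√(1 - a ^ 2))⁻¹ ≤ 2 + n * a ^ 2 := by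
  have hn' : (0 : ℝ) < n := by positivity
  have hs0 : 0 < 1 - a ^ 2 := lt_of_lt_of_le (by positivity) h
  have hle : 1 - a ^ 2 ≤ √(1 - a ^ 2) := le_sqrt_of_nonneg_of_le_one hs0.le (by nlinarith)
  have h1 : (√(1 - a ^ 2))⁻¹ ≤ (1 - a ^ 2)⁻¹ := inv_anti₀ hs0 hle
  rcases le_total (a ^ 2) (1 / 2) with h2 | h2
  · have : (1 - a ^ 2)⁻¹ ≤ 2 := by
      rw [inv_le_comm₀ hs0 (by norm_num)]; linarith
    nlinarith [sq_nonneg a]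
  · have : (1 - a ^ 2)⁻¹ ≤ (n : ℝ) / 2 := by
      rw [inv_le_comm₀ hs0 (by positivity), inv_div]; exact h
    nlinarith

/-- The left side is the inverse square root of a Gram determinant with overlaps `a`, `b`, `c`. It
is at most `1 + 4 q`, with `q = a ^ 2 + b ^ 2 + c ^ 2`, when `q` is small; otherwise the worst case
`n / 2` is dominated by the term with fourth powers, whose average is `O(1 / n)`. -/
theorem inv_sqrt_gram_le {n : ℕ} (hn : n ≠ 0) {a b c : ℝ} (hc : c ^ 2 ≤ 1)
    (h : (2 / (n : ℝ)) ^ 2 ≤ (1 - a ^ 2) * (1 - b ^ 2) - (c - a * b) ^ 2) :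
    (√((1 - a ^ 2) * (1 - b ^ 2) - (c - a * b) ^ 2))⁻¹ ≤
      1 + 4 * (a ^ 2 + b ^ 2 + c ^ 2) + 24 * n * (a ^ 4 + b ^ 4 + c ^ 4) := by
  set D := (1 - a ^ 2) * (1 - b ^ 2) - (c - a * b) ^ 2 with hD
  set q := a ^ 2 + b ^ 2 + c ^ 2 with hq
  have hn' : (0 : ℝ) < n := by positivity
  have hq0 : 0 ≤ q := by positivity
  have hfour : q ^ 2 ≤ 3 * (a ^ 4 + b ^ 4 + c ^ 4) := by
    nlinarith [sq_nonneg (a ^ 2 - b ^ 2), sq_nonneg (b ^ 2 - c ^ 2), sq_nonneg (a ^ 2 - c ^ 2)]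
  have hsqrt : 2 / (n : ℝ) ≤ √D := Real.le_sqrt_of_sq_le h
  have hpos : 0 < √D := lt_of_lt_of_le (by positivity) hsqrt
  rcases le_total q (1 / 4) with hq4 | hq4
  -- The determinant is `1 - q + 2abc`.
  · have habc : -q ≤ 2 * (a * b * c) := by
      have hc1 := abs_le.1 ((sq_le_one_iff_abs_le_one c).1 hc)
      nlinarith [sq_nonneg (a + b), sq_nonneg (a - b), sq_nonneg c]
    have hDq : 1 - 2 * q ≤ D := by rw [hD]; nlinarith
    have h1 : 1 - 2 * q ≤ √D :=
      (le_sqrt_of_nonneg_of_le_one (by linarith) (by linarith)).trans (Real.sqrt_le_sqrt hDq)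
    have h2 : (√D)⁻¹ ≤ (1 - 2 * q)⁻¹ := inv_anti₀ (by linarith) h1
    have h3 : (1 - 2 * q)⁻¹ ≤ 1 + 4 * q := by
      rw [inv_le_iff_one_le_mul₀ (by linarith)]
      nlinarith
    have : 0 ≤ 24 * n * (a ^ 4 + b ^ 4 + c ^ 4) := by positivity
    linarith
  · have h1 : (√D)⁻¹ ≤ n / 2 := by
      rw [inv_le_comm₀ hpos (by positivity), inv_div]; exact hsqrt
    have h2 : (1 : ℝ) / 16 ≤ q ^ 2 := by nlinarith
    have h3 : (1 : ℝ) / 48 ≤ a ^ 4 + b ^ 4 + c ^ 4 := by linarith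
    nlinarith

/-! ### First and second moment of the number of good partitions -/

/-- The second moment method: if `N` is the number of the events `A i` that occur, then the
indicator of `N ≠ 0` is at least `1 - (1 - l N) ^ 2 = 2 l N - l ^ 2 N ^ 2` for every `l`. -/
theorem le_measureReal_biUnion {Ω ι : Type*} [MeasurableSpace Ω] (μ : Measure Ω)
    [IsFiniteMeasure μ] (S : Finset ι) {A : ι → Set Ω} (hA : ∀ i, MeasurableSet (A i)) (l : ℝ) :
    2 * l * ∑ i ∈ S, μ.real (A i) - l ^ 2 * ∑ i ∈ S, ∑ j ∈ S, μ.real (A i ∩ A j) ≤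
      μ.real (⋃ i ∈ S, A i) := by
  have hint : ∀ B : Set Ω, MeasurableSet B → Integrable (B.indicator (1 : Ω → ℝ)) μ := fun B hB =>
    (integrable_const (1 : ℝ)).indicator hB
  have hU : MeasurableSet (⋃ i ∈ S, A i) := S.measurableSet_biUnion fun i _ => hA i
  have h1 : ∫ x, (∑ i ∈ S, (A i).indicator (1 : Ω → ℝ) x) ∂μ = ∑ i ∈ S, μ.real (A i) := by
    rw [integral_finsetSum _ fun i _ => hint _ (hA i)]
    exact Finset.sum_congr rfl fun i _ => integral_indicator_one (hA i)
  have hi2 : ∀ i j, Integrable (fun x => (A i ∩ A j).indicator (1 : Ω → ℝ) x) μ := fun i j =>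
    hint _ ((hA i).inter (hA j))
  have h2 : ∫ x, (∑ i ∈ S, ∑ j ∈ S, (A i ∩ A j).indicator (1 : Ω → ℝ) x) ∂μ =
      ∑ i ∈ S, ∑ j ∈ S, μ.real (A i ∩ A j) := by
    rw [integral_finsetSum _ fun i _ => integrable_finsetSum _ fun j _ => hi2 i j]
    refine Finset.sum_congr rfl fun i _ => ?_
    rw [integral_finsetSum _ fun j _ => hi2 i j]
    exact Finset.sum_congr rfl fun j _ => integral_indicator_one ((hA i).inter (hA j))
  have hI1 : Integrable (fun x => ∑ i ∈ S, (A i).indicator (1 : Ω → ℝ) x) μ :=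
    integrable_finsetSum _ fun i _ => hint _ (hA i)
  have hI2 : Integrable (fun x => ∑ i ∈ S, ∑ j ∈ S, (A i ∩ A j).indicator (1 : Ω → ℝ) x) μ :=
    integrable_finsetSum _ fun i _ => integrable_finsetSum _ fun j _ => hi2 i j
  rw [← h1, ← h2, ← integral_const_mul, ← integral_const_mul,
    ← integral_sub (hI1.const_mul _) (hI2.const_mul _), ← integral_indicator_one hU]
  refine integral_mono ((hI1.const_mul _).sub (hI2.const_mul _)) (hint _ hU) fun x => ?_
  have hsq : ∑ i ∈ S, ∑ j ∈ S, (A i ∩ A j).indicator (1 : Ω → ℝ) x =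
      (∑ i ∈ S, (A i).indicator (1 : Ω → ℝ) x) ^ 2 := by
    rw [sq, Finset.sum_mul_sum]
    simp only [Set.inter_indicator_one, Pi.mul_apply]
  simp only [hsq]
  by_cases hx : x ∈ ⋃ i ∈ S, A i
  · rw [Set.indicator_of_mem hx, Pi.one_apply]
    nlinarith [sq_nonneg (1 - l * ∑ i ∈ S, (A i).indicator (1 : Ω → ℝ) x)]
  · have h0 : ∑ i ∈ S, (A i).indicator (1 : Ω → ℝ) x = 0 :=
      Finset.sum_eq_zero fun i hi => Set.indicator_of_notMem
        (fun h => hx (Set.mem_biUnion hi h)) _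
    rw [h0, Set.indicator_of_notMem hx]
    simp

variable {n : ℕ}

/-- The set `otherPartitions σs` as a `Finset`. -/
def othersFinset (σs : Partition n) : Finset (Partition n) :=
  {σ | σ ≠ σs ∧ σ ≠ -σs}

theorem mem_othersFinset {σs σ : Partition n} :
    σ ∈ othersFinset σs ↔ σ ≠ σs ∧ σ ≠ -σs := by
  simp [othersFinset]

theorem le_card_othersFinset (σs : Partition n) :
    (2 : ℝ) ^ n - 2 ≤ (othersFinset σs).card := by
  have h : (Finset.univ : Finset (Partition n)) ⊆ othersFinset σs ∪ {σs, -σs} := by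
    intro σ _
    simp only [Finset.mem_union, mem_othersFinset, Finset.mem_insert, Finset.mem_singleton]
    tauto
  have h1 := (Finset.card_le_card h).trans (Finset.card_union_le _ _)
  have h2 : ({σs, -σs} : Finset (Partition n)).card ≤ 2 := Finset.card_le_two
  have h3 : (Finset.univ : Finset (Partition n)).card = 2 ^ n := by simp
  rw [h3] at h1
  have : 2 ^ n ≤ (othersFinset σs).card + 2 := h1.trans (by gcongr)
  have : ((2 ^ n : ℕ) : ℝ) ≤ ((othersFinset σs).card + 2 : ℕ) := by exact_mod_cast this
  push_cast at this
  linarith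

theorem setOf_hamiltonian_le (σ : Partition n) (b : ℝ) :
    {X | hamiltonian X σ ≤ b} = slab (unitVector σ) b := by
  ext X
  simp [slab, hamiltonian_eq]

theorem plantedMeasure_eq (σs : Partition n) :
    plantedMeasure σs = (stdGaussian (EuclideanSpace ℝ (Fin n)))[|slab (unitVector σs)
      ((3 : ℝ) ^ (-(n : ℤ)))] := by
  rw [plantedMeasure, setOf_hamiltonian_le]

/-- A nontrivial overlap is bounded away from `±1`. -/
theorem two_div_le_one_sub_inner_sq (hn : n ≠ 0) {σ τ : Partition n} (h1 : τ ≠ σ) (h2 : τ ≠ -σ) :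
    2 / (n : ℝ) ≤ 1 - ⟪unitVector σ, unitVector τ⟫ ^ 2 := by
  have h := two_div_le_norm_sub_sq hn h1 h2 h1 h2 ⟪unitVector σ, unitVector τ⟫ 0
  rwa [zero_smul, sub_zero, norm_sub_inner_smul_sq (norm_unitVector hn σ)
    (norm_unitVector hn τ)] at h

theorem sq_two_div_le_gramDet (hn : n ≠ 0) {ρ σ τ : Partition n} (hσ : σ ≠ ρ) (hσ' : σ ≠ -ρ)
    (h1 : τ ≠ ρ) (h2 : τ ≠ -ρ) (h3 : τ ≠ σ) (h4 : τ ≠ -σ) :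
    (2 / (n : ℝ)) ^ 2 ≤ gramDet (unitVector ρ) (unitVector σ) (unitVector τ) := by
  refine sq_le_gramDet (norm_unitVector hn ρ) (norm_unitVector hn σ) (norm_unitVector hn τ)
    (by positivity) (fun β => ?_) (two_div_le_norm_sub_sq hn h1 h2 h3 h4)
  simpa using two_div_le_norm_sub_sq hn hσ hσ' hσ hσ' β 0

theorem plantedMeasure_real_slab_le (hn : n ≠ 0) {σs σ : Partition n} (h1 : σ ≠ σs)
    (h2 : σ ≠ -σs) {b : ℝ} (hb : 0 ≤ b) :
    (plantedMeasure σs).real (slab (unitVector σ) b) ≤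
      2 * b * (√(2 * Real.pi))⁻¹ * (2 + n * ⟪unitVector σs, unitVector σ⟫ ^ 2) := by
  have h := two_div_le_one_sub_inner_sq hn h1 h2
  have hpos : 0 < 2 / (n : ℝ) := by positivity
  rw [plantedMeasure_eq]
  refine (cond_real_slab_le (norm_unitVector hn _) (norm_unitVector hn _) (by linarith)
    (by positivity) hb).trans ?_
  rw [div_eq_mul_inv]
  gcongr
  exact inv_sqrt_one_sub_le hn h

/-- The expected number of partitions other than `±σ*` with Hamiltonian at most `b`. -/
theorem sum_plantedMeasure_slab_le (hn : n ≠ 0) (σs : Partition n) {b : ℝ} (hb : 0 ≤ b) :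
    ∑ σ ∈ othersFinset σs, (plantedMeasure σs).real (slab (unitVector σ) b) ≤
      2 * b * (√(2 * Real.pi))⁻¹ * (3 * 2 ^ n) := by
  calc _ ≤ ∑ σ ∈ othersFinset σs,
        2 * b * (√(2 * Real.pi))⁻¹ * (2 + n * ⟪unitVector σs, unitVector σ⟫ ^ 2) :=
        Finset.sum_le_sum fun σ hσ => plantedMeasure_real_slab_le hn (mem_othersFinset.1 hσ).1
          (mem_othersFinset.1 hσ).2 hb
    _ ≤ ∑ σ, 2 * b * (√(2 * Real.pi))⁻¹ * (2 + n * ⟪unitVector σs, unitVector σ⟫ ^ 2) :=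
        Finset.sum_le_univ_sum_of_nonneg fun σ => by positivity
    _ = _ := by
        rw [← Finset.mul_sum, Finset.sum_add_distrib, ← Finset.mul_sum,
          sum_inner_unitVector_sq hn, mul_div_cancel₀ _ (Nat.cast_ne_zero.2 hn)]
        simp only [Finset.sum_const, Finset.card_univ, nsmul_eq_mul]
        rw [show (Fintype.card (Partition n) : ℝ) = 2 ^ n by simp]
        ring

theorem le_sum_plantedMeasure_slab (hn : n ≠ 0) (σs : Partition n) {b : ℝ}
    (hb : (3 : ℝ) ^ (-(n : ℤ)) ≤ b) :
    (2 ^ n - 2) * (2 * (b - (3 : ℝ) ^ (-(n : ℤ))) * (√(2 * Real.pi))⁻¹ *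
      Real.exp (-b ^ 2 / 2)) ≤
      ∑ σ ∈ othersFinset σs, (plantedMeasure σs).real (slab (unitVector σ) b) := by
  have h : ∀ σ ∈ othersFinset σs, 2 * (b - (3 : ℝ) ^ (-(n : ℤ))) * (√(2 * Real.pi))⁻¹ *
      Real.exp (-b ^ 2 / 2) ≤ (plantedMeasure σs).real (slab (unitVector σ) b) := fun σ _ => by
    rw [plantedMeasure_eq]
    exact le_cond_real_slab (norm_unitVector hn _) (norm_unitVector hn _) (by positivity) hb
  have hs := Finset.card_nsmul_le_sum _ _ _ h
  rw [nsmul_eq_mul] at hs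
  refine le_trans (mul_le_mul_of_nonneg_right (le_card_othersFinset σs) ?_) hs
  have := sub_nonneg.2 hb
  positivity

/-- The bound on the inverse square root of the Gram determinant, a polynomial in the overlaps
of `ρ`, `σ`, `τ` that is close to one on average. -/
noncomputable def overlapWeight (ρ σ τ : Partition n) : ℝ :=
  1 + 4 * (⟪unitVector ρ, unitVector σ⟫ ^ 2 + ⟪unitVector ρ, unitVector τ⟫ ^ 2 +
      ⟪unitVector σ, unitVector τ⟫ ^ 2) +
    24 * n * (⟪unitVector ρ, unitVector σ⟫ ^ 4 + ⟪unitVector ρ, unitVector τ⟫ ^ 4 +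
      ⟪unitVector σ, unitVector τ⟫ ^ 4)

theorem overlapWeight_nonneg (ρ σ τ : Partition n) : 0 ≤ overlapWeight ρ σ τ := by
  unfold overlapWeight
  positivity

theorem sum_overlapWeight_le (hn : n ≠ 0) (ρ : Partition n) :
    ∑ σ : Partition n, ∑ τ : Partition n, overlapWeight ρ σ τ ≤ (2 ^ n) ^ 2 * (1 + 228 / n) := by
  have hn' : (0 : ℝ) < n := by positivity
  have hcard : (Fintype.card (Partition n) : ℝ) = 2 ^ n := by simp
  have h2 := sum_inner_unitVector_sq hn
  have h4 := sum_inner_unitVector_pow_four_le hn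
  have hτ : ∀ σ : Partition n, ∑ τ : Partition n, overlapWeight ρ σ τ ≤
      2 ^ n * (1 + 152 / n) + 2 ^ n * (4 * ⟪unitVector ρ, unitVector σ⟫ ^ 2) +
        2 ^ n * (24 * n * ⟪unitVector ρ, unitVector σ⟫ ^ 4) := by
    intro σ
    simp only [overlapWeight, Finset.sum_add_distrib, ← Finset.mul_sum, h2, Finset.sum_const,
      Finset.card_univ, nsmul_eq_mul, hcard, mul_one]
    have hb : 24 * (n : ℝ) * (2 ^ n * ⟪unitVector ρ, unitVector σ⟫ ^ 4 +
        ∑ τ, ⟪unitVector ρ, unitVector τ⟫ ^ 4 + ∑ τ, ⟪unitVector σ, unitVector τ⟫ ^ 4) ≤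
        24 * n * (2 ^ n * ⟪unitVector ρ, unitVector σ⟫ ^ 4 + 2 ^ n * 3 / n ^ 2 +
          2 ^ n * 3 / n ^ 2) := by
      gcongr
      · exact h4 ρ
      · exact h4 σ
    refine (add_le_add_right hb _).trans_eq ?_
    field_simp
    ring
  refine (Finset.sum_le_sum fun σ _ => hτ σ).trans ?_
  simp only [Finset.sum_add_distrib, ← Finset.mul_sum, h2, Finset.sum_const,
    Finset.card_univ, nsmul_eq_mul, hcard]
  have hb : (2 : ℝ) ^ n * (24 * n * ∑ σ, ⟪unitVector ρ, unitVector σ⟫ ^ 4) ≤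
      2 ^ n * (24 * n * (2 ^ n * 3 / n ^ 2)) := by
    gcongr
    exact h4 ρ
  refine (add_le_add_right hb _).trans_eq ?_
  field_simp
  ring

/-- The pair `(σ, τ)` contributes to the second moment either through the diagonal `τ = ±σ`, or
through the joint small-ball bound. -/
theorem plantedMeasure_real_slab_inter_slab_le (hn : n ≠ 0) {σs σ τ : Partition n}
    (hσ : σ ∈ othersFinset σs) (hτ : τ ∈ othersFinset σs) {b : ℝ} (hb : 0 ≤ b) :
    (plantedMeasure σs).real (slab (unitVector σ) b ∩ slab (unitVector τ) b) ≤
      (if τ = σ then (plantedMeasure σs).real (slab (unitVector σ) b) else 0) +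
      (if τ = -σ then (plantedMeasure σs).real (slab (unitVector σ) b) else 0) +
      (2 * b * (√(2 * Real.pi))⁻¹) ^ 2 * overlapWeight σs σ τ := by
  have hfin : IsFiniteMeasure (plantedMeasure σs) := by rw [plantedMeasure_eq]; infer_instance
  have hp : 0 ≤ (plantedMeasure σs).real (slab (unitVector σ) b) := measureReal_nonneg
  have hw : 0 ≤ (2 * b * (√(2 * Real.pi))⁻¹) ^ 2 * overlapWeight σs σ τ :=
    mul_nonneg (sq_nonneg _) (overlapWeight_nonneg _ _ _)
  have hle : (plantedMeasure σs).real (slab (unitVector σ) b ∩ slab (unitVector τ) b) ≤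
      (plantedMeasure σs).real (slab (unitVector σ) b) := measureReal_mono Set.inter_subset_left
  by_cases h3 : τ = σ
  · rw [if_pos h3]
    split_ifs <;> linarith
  by_cases h4 : τ = -σ
  · rw [if_pos h4, if_neg h3]
    linarith
  rw [if_neg h3, if_neg h4, zero_add, zero_add]
  obtain ⟨hσ1, hσ2⟩ := mem_othersFinset.1 hσ
  obtain ⟨hτ1, hτ2⟩ := mem_othersFinset.1 hτ
  have hD := sq_two_div_le_gramDet hn hσ1 hσ2 hτ1 hτ2 h3 h4
  have hpos : 0 < (2 / (n : ℝ)) ^ 2 := by positivity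
  rw [plantedMeasure_eq]
  refine (cond_real_slab_inter_slab_le (norm_unitVector hn _) (norm_unitVector hn _)
    (norm_unitVector hn _) (hpos.trans_le hD) (by positivity) hb).trans ?_
  rw [div_eq_mul_inv]
  gcongr
  exact inv_sqrt_gram_le hn (inner_sq_le_one (norm_unitVector hn _) (norm_unitVector hn _)) hD

/-- The second moment of the number of partitions other than `±σ*` with Hamiltonian at most
`b`. -/
theorem sum_sum_plantedMeasure_slab_le (hn : n ≠ 0) (σs : Partition n) {b : ℝ} (hb : 0 ≤ b) :
    ∑ σ ∈ othersFinset σs, ∑ τ ∈ othersFinset σs,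
      (plantedMeasure σs).real (slab (unitVector σ) b ∩ slab (unitVector τ) b) ≤
      2 * (2 * b * (√(2 * Real.pi))⁻¹ * (3 * 2 ^ n)) +
        (2 * b * (√(2 * Real.pi))⁻¹) ^ 2 * ((2 ^ n) ^ 2 * (1 + 228 / n)) := by
  have hite : ∀ ρ : Partition n, ∀ p : ℝ, 0 ≤ p →
      ∑ τ ∈ othersFinset σs, (if τ = ρ then p else 0) ≤ p := fun ρ p hp => by
    rw [Finset.sum_ite_eq']
    split_ifs <;> simp [hp]
  calc _ ≤ ∑ σ ∈ othersFinset σs, (2 * (plantedMeasure σs).real (slab (unitVector σ) b) +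
        (2 * b * (√(2 * Real.pi))⁻¹) ^ 2 * ∑ τ, overlapWeight σs σ τ) := by
        refine Finset.sum_le_sum fun σ hσ => ?_
        refine (Finset.sum_le_sum fun τ hτ =>
          plantedMeasure_real_slab_inter_slab_le hn hσ hτ hb).trans ?_
        rw [Finset.sum_add_distrib, Finset.sum_add_distrib, ← Finset.mul_sum,
          two_mul ((plantedMeasure σs).real _)]
        refine add_le_add (add_le_add (hite σ _ measureReal_nonneg)
          (hite (-σ) _ measureReal_nonneg)) (mul_le_mul_of_nonneg_left ?_ (sq_nonneg _))
        exact Finset.sum_le_univ_sum_of_nonneg fun τ => overlapWeight_nonneg _ _ _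
    _ ≤ _ := by
        rw [Finset.sum_add_distrib, ← Finset.mul_sum, ← Finset.mul_sum]
        gcongr
        · exact sum_plantedMeasure_slab_le hn σs hb
        · refine le_trans (Finset.sum_le_univ_sum_of_nonneg fun σ => ?_)
            (sum_overlapWeight_le hn σs)
          exact Finset.sum_nonneg fun τ _ => overlapWeight_nonneg _ _ _

/-! ### The ground state -/

theorem groundStateValue_le_iff (hn : 2 ≤ n) (σs : Partition n) (X : EuclideanSpace ℝ (Fin n))
    (b : ℝ) :
    groundStateValue σs X ≤ b ↔ X ∈ ⋃ σ ∈ othersFinset σs, slab (unitVector σ) b := by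
  have hleast := isLeast_groundStateValue hn σs X
  simp only [Set.mem_iUnion, exists_prop, ← setOf_hamiltonian_le, Set.mem_ofPred_eq]
  constructor
  · intro h
    obtain ⟨σ, hσ, hσX⟩ := hleast.1
    exact ⟨σ, mem_othersFinset.2 hσ, hσX.le.trans h⟩
  · rintro ⟨σ, hσ, hσX⟩
    exact (hleast.2 ⟨σ, mem_othersFinset.1 hσ, rfl⟩).trans hσX

/-- The event that the ground state value lies between `b₁` and `b₂` has probability at least the
second moment bound at scale `b₂` minus the union bound at scale `b₁`. -/
theorem le_plantedMeasure_real_groundState (hn : 2 ≤ n) (σs : Partition n) {b₁ b₂ : ℝ}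
    (hb₁ : 0 ≤ b₁) {L : ℝ} (hL : 0 < L) (hb₂ : 0 ≤ b₂)
    (hL' : L ≤ ∑ σ ∈ othersFinset σs, (plantedMeasure σs).real (slab (unitVector σ) b₂)) :
    2 - (2 * (2 * b₂ * (√(2 * Real.pi))⁻¹ * (3 * 2 ^ n)) +
        (2 * b₂ * (√(2 * Real.pi))⁻¹) ^ 2 * ((2 ^ n) ^ 2 * (1 + 228 / n))) / L ^ 2 -
      2 * b₁ * (√(2 * Real.pi))⁻¹ * (3 * 2 ^ n) ≤
      (plantedMeasure σs).real
        {X | b₁ ≤ groundStateValue σs X ∧ groundStateValue σs X ≤ b₂} := by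
  have hn0 : n ≠ 0 := by omega
  have hfin : IsFiniteMeasure (plantedMeasure σs) := by rw [plantedMeasure_eq]; infer_instance
  have hsub : (⋃ σ ∈ othersFinset σs, slab (unitVector σ) b₂) \
      (⋃ σ ∈ othersFinset σs, slab (unitVector σ) b₁) ⊆
      {X | b₁ ≤ groundStateValue σs X ∧ groundStateValue σs X ≤ b₂} := by
    rintro X ⟨h2, h1⟩
    rw [← groundStateValue_le_iff hn] at h1 h2
    exact ⟨(not_le.1 h1).le, h2⟩
  have hdiff := le_measureReal_sdiff (μ := plantedMeasure σs)
    (s₁ := ⋃ σ ∈ othersFinset σs, slab (unitVector σ) b₂)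
    (s₂ := ⋃ σ ∈ othersFinset σs, slab (unitVector σ) b₁) (measure_ne_top _ _)
  have hunion : (plantedMeasure σs).real (⋃ σ ∈ othersFinset σs, slab (unitVector σ) b₁) ≤ _ :=
    (measureReal_biUnion_finset_le _ _).trans (sum_plantedMeasure_slab_le hn0 σs hb₁)
  have hsecond := le_measureReal_biUnion (plantedMeasure σs) (othersFinset σs)
    (A := fun σ => slab (unitVector σ) b₂) (fun σ => measurableSet_slab _ _) L⁻¹
  have hQ := sum_sum_plantedMeasure_slab_le hn0 σs hb₂
  have hmono := measureReal_mono (μ := plantedMeasure σs) hsub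
  -- The second moment method with `l = L⁻¹`, where `L` bounds the first moment from below.
  have h1 : 2 ≤ 2 * L⁻¹ *
      ∑ σ ∈ othersFinset σs, (plantedMeasure σs).real (slab (unitVector σ) b₂) := by
    rw [mul_assoc, ← div_eq_inv_mul]
    have := (one_le_div hL).2 hL'
    linarith
  have h2 := mul_le_mul_of_nonneg_left hQ (by positivity : 0 ≤ L⁻¹ ^ 2)
  rw [inv_pow, ← div_eq_inv_mul (_ + _)] at h2
  rw [inv_pow] at hsecond
  linarith

theorem tendsto_min_natCast_atTop {g : ℕ → ℝ} (hg : Tendsto g atTop atTop) :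
    Tendsto (fun n => min (g n) n) atTop atTop := by
  refine tendsto_atTop.2 fun c => ?_
  filter_upwards [tendsto_atTop.1 hg c, tendsto_atTop.1 tendsto_natCast_atTop_atTop c]
    with n h1 h2 using le_min h1 h2

/-- The ratio of the bound on the second moment to the square of the bound on the first moment
tends to one. -/
theorem tendsto_secondMoment_ratio {γ : ℕ → ℝ} (hγ : Tendsto γ atTop atTop)
    (hγn : ∀ n, γ n ≤ n) (κ : ℝ) :
    Tendsto (fun n : ℕ => (6 / κ * (γ n)⁻¹ + (1 + 228 / n)) /
      ((1 - 2 * (1 / 2) ^ n) * (1 - (2 / 3) ^ n * (γ n)⁻¹) *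
        Real.exp (-(γ n * (1 / 2) ^ n) ^ 2 / 2)) ^ 2) atTop (𝓝 1) := by
  have hinv : Tendsto (fun n => (γ n)⁻¹) atTop (𝓝 0) := tendsto_inv_atTop_zero.comp hγ
  have h228 : Tendsto (fun n : ℕ => (228 : ℝ) / n) atTop (𝓝 0) :=
    tendsto_const_div_atTop_nhds_zero_nat _
  have h12 : Tendsto (fun n : ℕ => ((1 : ℝ) / 2) ^ n) atTop (𝓝 0) :=
    tendsto_pow_atTop_nhds_zero_of_lt_one (by norm_num) (by norm_num)
  have h23 : Tendsto (fun n : ℕ => ((2 : ℝ) / 3) ^ n) atTop (𝓝 0) :=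
    tendsto_pow_atTop_nhds_zero_of_lt_one (by norm_num) (by norm_num)
  have hb : Tendsto (fun n : ℕ => γ n * (1 / 2) ^ n) atTop (𝓝 0) := by
    refine squeeze_zero' ?_ (Eventually.of_forall fun n => ?_)
      (tendsto_self_mul_const_pow_of_lt_one (r := 1 / 2) (by norm_num) (by norm_num))
    · filter_upwards [hγ.eventually_ge_atTop 0] with n hn
      positivity
    · exact mul_le_mul_of_nonneg_right (hγn n) (by positivity)
  have hexp : Tendsto (fun n : ℕ => Real.exp (-(γ n * (1 / 2) ^ n) ^ 2 / 2)) atTop (𝓝 1) := by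
    have h := (Real.continuous_exp.tendsto _).comp (((hb.pow 2).neg).div_const 2)
    simpa [Function.comp_def] using h
  have h := ((hinv.const_mul (6 / κ)).add (h228.const_add 1)).div
    ((((h12.const_mul 2).const_sub 1).mul ((h23.mul hinv).const_sub 1)).mul hexp |>.pow 2)
    (by norm_num)
  simpa [Pi.div_def] using h

end PlantedNPP

theorem mainTheorem1 (f g : ℕ → ℝ) (hf_pos : ∀ n, 0 < f n) (hg_pos : ∀ n, 0 < g n)
    (hf : Tendsto f atTop (𝓝 0)) (hg : Tendsto g atTop atTop)
    (σs : (n : ℕ) → PlantedNPP.Partition n) :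
    Tendsto
      (fun n : ℕ => PlantedNPP.plantedMeasure (σs n)
        {X | f n * (2 : ℝ) ^ (-(n : ℤ)) ≤ PlantedNPP.groundStateValue (σs n) X ∧
          PlantedNPP.groundStateValue (σs n) X ≤ g n * (2 : ℝ) ^ (-(n : ℤ))})
      atTop (𝓝 1) := by
  have hprob : ∀ n, IsZeroOrProbabilityMeasure (PlantedNPP.plantedMeasure (σs n)) := fun n => by
    rw [PlantedNPP.plantedMeasure_eq]; infer_instance
  set E : (n : ℕ) → Set (EuclideanSpace ℝ (Fin n)) := fun n =>
    {X | f n * (2 : ℝ) ^ (-(n : ℤ)) ≤ PlantedNPP.groundStateValue (σs n) X ∧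
      PlantedNPP.groundStateValue (σs n) X ≤ g n * (2 : ℝ) ^ (-(n : ℤ))} with hE
  suffices h : Tendsto (fun n => (PlantedNPP.plantedMeasure (σs n)).real (E n)) atTop (𝓝 1) by
    have := ENNReal.tendsto_ofReal h
    rw [ENNReal.ofReal_one] at this
    exact this.congr fun n => ofReal_measureReal (measure_ne_top _ _)
  -- Replacing `g` by the smaller `γ` only shrinks the event, and makes `γ n * 2 ^ (-n)` tend to
  -- zero, as the factor `exp (-b ^ 2 / 2)` in the first moment requires.
  set γ : ℕ → ℝ := fun n => min (g n) n with hγdef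
  have hγ : Tendsto γ atTop atTop := PlantedNPP.tendsto_min_natCast_atTop hg
  set κ : ℝ := 2 * (√(2 * Real.pi))⁻¹ with hκ
  have hκ0 : 0 < κ := by positivity
  have hR := PlantedNPP.tendsto_secondMoment_ratio hγ (fun n => min_le_right _ _) κ
  have hlow := (hR.const_sub 2).sub (hf.const_mul (3 * κ))
  rw [mul_zero, sub_zero, show (2 : ℝ) - 1 = 1 by norm_num] at hlow
  refine tendsto_of_tendsto_of_tendsto_of_le_of_le' hlow tendsto_const_nhds ?_
    (Eventually.of_forall fun n => measureReal_le_one)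
  filter_upwards [eventually_ge_atTop 2, hγ.eventually_ge_atTop 1] with n hn hγ1
  have h2 : (2 : ℝ) ^ (-(n : ℤ)) = (1 / 2) ^ n := by simp
  have h3 : (3 : ℝ) ^ (-(n : ℤ)) = (1 / 2) ^ n * (2 / 3) ^ n := by
    rw [← mul_pow, zpow_neg, zpow_natCast, ← inv_pow]
    norm_num
  have h22 : (2 : ℝ) ^ n * (1 / 2) ^ n = 1 := by rw [← mul_pow]; norm_num
  have hp : (0 : ℝ) < (1 / 2) ^ n := by positivity
  have hq : ((2 : ℝ) / 3) ^ n < 1 := pow_lt_one₀ (by norm_num) (by norm_num) (by omega)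
  have hhalf : 2 * ((1 : ℝ) / 2) ^ n < 1 := by
    have : ((1 : ℝ) / 2) ^ n ≤ (1 / 2) ^ 2 := pow_le_pow_of_le_one (by norm_num) (by norm_num) hn
    linarith
  have hb : (3 : ℝ) ^ (-(n : ℤ)) ≤ γ n * (1 / 2) ^ n := by
    rw [h3, mul_comm]
    gcongr
    linarith
  have hqγ : ((2 : ℝ) / 3) ^ n * (γ n)⁻¹ < 1 := by
    rw [← div_eq_mul_inv, div_lt_one (by linarith)]
    linarith
  have hL' := PlantedNPP.le_sum_plantedMeasure_slab (by omega) (σs n) hb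
  set D := (1 - 2 * ((1 : ℝ) / 2) ^ n) * (1 - (2 / 3) ^ n * (γ n)⁻¹) *
    Real.exp (-(γ n * (1 / 2) ^ n) ^ 2 / 2) with hD
  have hD0 : 0 < D := mul_pos (mul_pos (by linarith) (by linarith)) (Real.exp_pos _)
  have hγ0 : 0 < γ n := by linarith
  have hLD : (2 ^ n - 2) * (2 * (γ n * (1 / 2) ^ n - (3 : ℝ) ^ (-(n : ℤ))) *
      (√(2 * Real.pi))⁻¹ * Real.exp (-(γ n * (1 / 2) ^ n) ^ 2 / 2)) = κ * γ n * D := by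
    have e1 : γ n * (1 / 2) ^ n - (3 : ℝ) ^ (-(n : ℤ)) =
        (1 / 2) ^ n * (γ n * (1 - (2 / 3) ^ n * (γ n)⁻¹)) := by
      rw [h3]
      field_simp
    have e2 : (2 : ℝ) ^ n - 2 = 2 ^ n * (1 - 2 * (1 / 2) ^ n) := by linear_combination 2 * h22
    rw [e1, e2, hD, hκ]
    linear_combination (2 * (1 - 2 * (1 / 2) ^ n) * (γ n * (1 - (2 / 3) ^ n * (γ n)⁻¹)) *
      (√(2 * Real.pi))⁻¹ * Real.exp (-(γ n * (1 / 2) ^ n) ^ 2 / 2)) * h22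
  rw [hLD] at hL'
  have hmain := PlantedNPP.le_plantedMeasure_real_groundState hn (σs n)
    (b₁ := f n * (1 / 2) ^ n) (mul_nonneg (hf_pos n).le hp.le) (by positivity : 0 < κ * γ n * D)
    (by positivity) hL'
  have hsub : {X | f n * (1 / 2) ^ n ≤ PlantedNPP.groundStateValue (σs n) X ∧
      PlantedNPP.groundStateValue (σs n) X ≤ γ n * (1 / 2) ^ n} ⊆ E n := by
    rintro X ⟨hX1, hX2⟩
    simp only [hE, h2, Set.mem_ofPred_eq]
    exact ⟨hX1, hX2.trans (mul_le_mul_of_nonneg_right (min_le_left _ _) hp.le)⟩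
  refine le_trans (le_of_eq ?_) (hmain.trans (measureReal_mono hsub))
  have e3 : 2 * (f n * (1 / 2) ^ n) * (√(2 * Real.pi))⁻¹ * (3 * 2 ^ n) = 3 * κ * f n := by
    rw [hκ]
    linear_combination (6 * f n * (√(2 * Real.pi))⁻¹) * h22
  have e4 : 2 * (2 * (γ n * (1 / 2) ^ n) * (√(2 * Real.pi))⁻¹ * (3 * 2 ^ n)) +
      (2 * (γ n * (1 / 2) ^ n) * (√(2 * Real.pi))⁻¹) ^ 2 * ((2 ^ n) ^ 2 * (1 + 228 / n)) =
      (κ * γ n) ^ 2 * (6 / κ * (γ n)⁻¹ + (1 + 228 / n)) := by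
    have e5 : 2 * (γ n * (1 / 2) ^ n) * (√(2 * Real.pi))⁻¹ = κ * γ n * (1 / 2) ^ n := by
      rw [hκ]; ring
    have e6 : (κ * γ n) ^ 2 * (6 / κ * (γ n)⁻¹) = 6 * (κ * γ n) := by field_simp
    rw [e5, mul_add (_ ^ 2) (6 / κ * _), e6]
    linear_combination (6 * (κ * γ n) + (κ * γ n) ^ 2 * (1 + 228 / n) *
      ((2 : ℝ) ^ n * (1 / 2) ^ n + 1)) * h22
  rw [e3, e4, mul_pow (κ * γ n) D, mul_div_mul_left _ _ (by positivity)]
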